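/- Let $q$ be a prime power and let $K\ge 2$, $0\le T\le K-2$ and $1\le G\le K$ be integers. There are $K$ users and a server. User $k\in[K]=\{1,\dots,K\}$ holds an input $W_k\in\mathbb F_q^{L}$, $L\ge 1$, and for every set $\mathcal G\subseteq[K]$ with $|\mathcal G|=G$ there is a groupwise key $S_{\mathcal G}\in\mathbb F_q^{L_S}$; all symbols of all $W_k$ and all $S_{\mathcal G}$ are i.i.d. uniform on $\mathbb F_q$. User $k$ knows the keys $Z_k=(S_{\mathcal G})_{\mathcal G\ni k}$ and sends to the server a message $X_k\in\mathbb F_q^{L_X}$ that is a function of $(W_k,Z_k)$. Such a scheme is a secure summation scheme if it satisfies - (correctness) $H\big(\sum_{k\in[K]}W_k\,\big|\,(X_k)_{k\in[K]}\big)=0$, and - (security) $I\big((W_k)_{k\in[K]};(X_k)_{k\in[K]}\,\big|\,\sum_{k\in[K]}W_k,(W_k,Z_k)_{k\in\mathcal T}\big)=0$ for every $\mathcal T\subseteq[K]$ with $|\mathcal T|\le T$. A pair $(R,R_S)\in\mathbb R^2$ is achievable if some secure summation scheme (with some $L\ge1$, $L_X$, $L_S$) has $L_X/L\le R$ and $L_S/L\le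 R_S$. Let $\mathcal R_g^*$ be the closure of the set of achievable pairs. Then $$\mathcal R_g^*=\begin{cases}\emptyset & \text{if } G>K-T \text{ or } G=1,\\[2pt] \Big\{(R,R_S): R\ge 1,\ R_S\ge \dfrac{K-T-1}{\binom{K-T}{G}}\Big\} & \text{if } 2\le G\le K-T.\end{cases}$$ -/

import Mathlib

namespace SecureSummation

noncomputable section

/-! ### Shannon entropy of random variables on a finite, uniformly distributed sample space -/

section Entropy

/-- The Shannon entropy, in `q`-ary units, of a distribution on a finite alphabet:
`H(p) = -∑ a, p a * log_q (p a)` (with `0 log 0 = 0`). -/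
def pmfEntropy (q : ℕ) {α : Type*} [Fintype α] (p : PMF α) : ℝ :=
  (∑ a, Real.negMulLog (p a).toReal) / Real.log q

variable {Ω α β γ : Type*} [Fintype Ω] [Nonempty Ω] [Fintype α] [Fintype β] [Fintype γ]

/-- The entropy `H(X)` in `q`-ary units of a random variable `X` defined on the uniform
probability space `Ω`, i.e. the entropy of the law of `X`. -/
def entropy (q : ℕ) (X : Ω → α) : ℝ :=
  pmfEntropy q ((PMF.uniformOfFintype Ω).map X)

/-- The conditional entropy `H(X | Y) = H(X, Y) - H(Y)`. -/
def condEntropy (q : ℕ) (X : Ω → α) (Y : Ω → β) : ℝ :=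
  entropy q (fun ω => (X ω, Y ω)) - entropy q Y

/-- The conditional mutual information `I(X; Y | V) = H(X | V) - H(X | Y, V)`. -/
def condMutualInfo (q : ℕ) (X : Ω → α) (Y : Ω → β) (V : Ω → γ) : ℝ :=
  condEntropy q X V - condEntropy q X (fun ω => (Y ω, V ω))

end Entropy

/-! ### The secure summation problem with symmetric groupwise keys -/

/-- The groups: all subsets of the `K` users with exactly `G` elements. -/
abbrev Group (K G : ℕ) : Type := {A : Finset (Fin K) // A.card = G}

/-- The groups that contain user `k`. -/
abbrev GroupOf (K G : ℕ) (k : Fin K) : Type := {A : Group K G // k ∈ A.1}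

/-- The key variable `Z k` of user `k` takes values in the tuples of groupwise keys
(`LS` symbols each) of all groups that contain `k`. -/
abbrev UserKey (F : Type*) (K G LS : ℕ) (k : Fin K) : Type _ :=
  GroupOf K G k → Fin LS → F

/-- The sample space: one input of `L` symbols for every user and one key of `LS` symbols for
every group. It carries the uniform distribution, so that all the input symbols and all the key
symbols are i.i.d. uniform on `F`. -/
abbrev Sample (F : Type*) (K G L LS : ℕ) : Type _ :=
  (Fin K → Fin L → F) × (Group K G → Fin LS → F)

/-- A scheme: the message of user `k`, made of `LX` symbols, is a function of the input and of
the key variable of user `k`. -/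
abbrev Scheme (F : Type*) (K G L LX LS : ℕ) : Type _ :=
  (k : Fin K) → (Fin L → F) → UserKey F K G LS k → (Fin LX → F)

section Model

variable {F : Type*} {K G L LX LS : ℕ}

/-- The input `W k`. -/
def input (k : Fin K) (ω : Sample F K G L LS) : Fin L → F := ω.1 k

/-- The key variable `Z k`. -/
def userKey (k : Fin K) (ω : Sample F K G L LS) : UserKey F K G LS k := fun A => ω.2 A.1

/-- The message `X k`. -/
def message (c : Scheme F K G L LX LS) (k : Fin K) (ω : Sample F K G L LS) : Fin LX → F :=
  c k (input k ω) (userKey k ω)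

variable [Field F]

/-- The sum of all the inputs. -/
def inputSum (ω : Sample F K G L LS) : Fin L → F := ∑ k, input k ω

variable [Fintype F]

/-- Correctness: `H(∑ W k | (X k)) = 0`. -/
def IsCorrect (c : Scheme F K G L LX LS) : Prop :=
  condEntropy (Fintype.card F) (inputSum : Sample F K G L LS → Fin L → F)
    (fun ω (k : Fin K) => message c k ω) = 0

/-- Security against the server colluding with any set `C` of at most `T` users:
`I((W k); (X k) | ∑ W k, (W k, Z k) for k in C) = 0`. -/
def IsSecure (T : ℕ) (c : Scheme F K G L LX LS) : Prop :=
  ∀ C : Finset (Fin K), C.card ≤ T →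
    condMutualInfo (Fintype.card F)
      (fun (ω : Sample F K G L LS) (k : Fin K) => input k ω)
      (fun ω (k : Fin K) => message c k ω)
      (fun ω => (inputSum ω, fun k : {k // k ∈ C} => (input k.1 ω, userKey k.1 ω))) = 0

end Model

/-- The set of achievable rate pairs `(R, R_S)`: some correct and secure scheme, with inputs of
`L ≥ 1` symbols, has `LX / L ≤ R` and `LS / L ≤ R_S`. -/
def achievable (F : Type*) [Field F] [Fintype F] (K T G : ℕ) : Set (ℝ × ℝ) :=
  {r | ∃ L LX LS : ℕ, 0 < L ∧ ∃ c : Scheme F K G L LX LS, IsCorrect c ∧ IsSecure T c ∧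
    (LX : ℝ) / L ≤ r.1 ∧ (LS : ℝ) / L ≤ r.2}

/-- The optimal rate region: the closure of the set of achievable rate pairs. -/
def optimalRegion (F : Type*) [Field F] [Fintype F] (K T G : ℕ) : Set (ℝ × ℝ) :=
  closure (achievable F K T G)

end

end SecureSummation

/-! Entropy enters only through fibre counts. If a conditional mutual information vanishes, the
conditional supports form a product (`exists_joint_of_condMutualInfo_eq_zero`). Hence the messages
sent for some inputs can also arise from any other inputs with the same sum, if the data of the
colluders agree, and the colluders' keys stay the same.

Converse: correctness makes each encoder injective for a fixed key, so `L ≤ LX`. Fix `T` colluders.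
The zero input must be able to produce the messages of every zero-sum input vanishing on the
colluders. Such inputs have `(K - T - 1) * L` free symbols, and different ones force different
values of the `(K - T).choose G` keys unknown to the colluders (`key_length_le`). If `K - T < G`
there are no such keys; if `G = 1` each message reveals its input.

Achievability: users add linear images of the keys that cancel in the total. Security follows once
the keys unknown to `C` can produce every zero-sum mask vanishing on `C`. For one `C`, stars
symmetrised over all permutations do this with exactly the minimal key length
(`exists_unknownKeyMatrix_right_inverse`). Right invertibility is an open polynomial condition, so
one choice over a finite extension `E` serves all `C` of size `T` (`exists_common_right_inverse`).
Reading `E` as a vector space over `F` preserves the rates. -/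

namespace SecureSummation

/-! ### Entropy as fibre counting. -/

section EntropyCount

variable {Ω α β γ : Type*} [Fintype Ω]

open Classical in
/-- The number of sample points at which `X` takes the value `a`. -/
noncomputable def fiberCard (X : Ω → α) (a : α) : ℕ := (Finset.univ.filter fun ω => X ω = a).card

lemma fiberCard_pos (X : Ω → α) (ω : Ω) : 0 < fiberCard X (X ω) :=
  Finset.card_pos.2 ⟨ω, by simp⟩

lemma exists_of_fiberCard_pos {X : Ω → α} {a : α} (h : 0 < fiberCard X a) : ∃ ω, X ω = a := by
  obtain ⟨ω, hω⟩ := Finset.card_pos.1 h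
  exact ⟨ω, by simpa using hω⟩

lemma sum_fiberCard_mul [Fintype α] (X : Ω → α) (f : α → ℝ) :
    ∑ a, (fiberCard X a : ℝ) * f a = ∑ ω, f (X ω) := by
  classical
  rw [← Finset.sum_fiberwise Finset.univ X (fun ω => f (X ω))]
  refine Finset.sum_congr rfl fun a _ => ?_
  rw [Finset.sum_congr rfl (g := fun _ => f a)
    (fun ω hω => by rw [(Finset.mem_filter.1 hω).2])]
  simp [fiberCard]

lemma sum_fiberCard_prod_left [Fintype α] (X : Ω → α) (Y : Ω → β) (b : β) :
    ∑ a, fiberCard (fun ω => (X ω, Y ω)) (a, b) = fiberCard Y b := by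
  classical
  unfold fiberCard
  rw [Finset.card_eq_sum_card_fiberwise (f := X) (t := Finset.univ) (fun _ _ => by simp)]
  refine Finset.sum_congr rfl fun a _ => ?_
  rw [Finset.filter_filter]
  congr 1
  ext ω
  simp [and_comm]

lemma fiberCard_prod_le (X : Ω → α) (Y : Ω → β) (a : α) (b : β) :
    fiberCard (fun ω => (X ω, Y ω)) (a, b) ≤ fiberCard Y b := by
  refine Finset.card_le_card fun ω hω => ?_
  simp only [Finset.mem_filter, Finset.mem_univ, true_and, Prod.mk.injEq] at hω ⊢
  exact hω.2

variable [Nonempty Ω]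

lemma map_uniform_apply (X : Ω → α) (a : α) :
    (((PMF.uniformOfFintype Ω).map X) a).toReal = (fiberCard X a : ℝ) / Fintype.card Ω := by
  classical
  rw [PMF.map_apply, tsum_fintype]
  simp only [PMF.uniformOfFintype_apply]
  rw [← Finset.sum_filter, Finset.sum_const, nsmul_eq_mul, ENNReal.toReal_mul]
  simp [fiberCard, div_eq_mul_inv, eq_comm]

lemma entropy_eq [Fintype α] (q : ℕ) (X : Ω → α) :
    entropy q X = (∑ ω, (Real.log (Fintype.card Ω) - Real.log (fiberCard X (X ω)))) /
      (Fintype.card Ω * Real.log q) := by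
  have hΩ : (Fintype.card Ω : ℝ) ≠ 0 := by exact_mod_cast Fintype.card_ne_zero
  unfold entropy pmfEntropy
  have : ∀ a, Real.negMulLog (((PMF.uniformOfFintype Ω).map X) a).toReal =
      (fiberCard X a : ℝ) * ((Real.log (Fintype.card Ω) - Real.log (fiberCard X a)) /
        Fintype.card Ω) := by
    intro a
    rw [map_uniform_apply, Real.negMulLog]
    rcases Nat.eq_zero_or_pos (fiberCard X a) with h | h
    · simp [h]
    · rw [Real.log_div (by exact_mod_cast h.ne') hΩ]
      ring
  rw [Finset.sum_congr rfl fun a _ => this a, sum_fiberCard_mul X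
    (fun a => (Real.log (Fintype.card Ω) - Real.log (fiberCard X a)) / Fintype.card Ω),
    ← Finset.sum_div, div_div]

lemma condEntropy_eq [Fintype α] [Fintype β] (q : ℕ) (X : Ω → α) (Y : Ω → β) :
    condEntropy q X Y = (∑ ω, (Real.log (fiberCard Y (Y ω)) -
      Real.log (fiberCard (fun ω => (X ω, Y ω)) (X ω, Y ω)))) /
      (Fintype.card Ω * Real.log q) := by
  rw [condEntropy, entropy_eq, entropy_eq, ← sub_div, ← Finset.sum_sub_distrib]
  congr 1
  exact Finset.sum_congr rfl fun ω _ => by ring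

lemma condMutualInfo_eq [Fintype α] [Fintype β] [Fintype γ] (q : ℕ)
    (X : Ω → α) (Y : Ω → β) (V : Ω → γ) :
    condMutualInfo q X Y V = (∑ ω, ((Real.log (fiberCard V (V ω)) +
        Real.log (fiberCard (fun ω => (X ω, Y ω, V ω)) (X ω, Y ω, V ω))) -
      (Real.log (fiberCard (fun ω => (X ω, V ω)) (X ω, V ω)) +
        Real.log (fiberCard (fun ω => (Y ω, V ω)) (Y ω, V ω))))) /
      (Fintype.card Ω * Real.log q) := by
  rw [condMutualInfo, condEntropy_eq, condEntropy_eq, ← sub_div, ← Finset.sum_sub_distrib]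
  congr 1
  exact Finset.sum_congr rfl fun ω _ => by ring

lemma card_mul_log_pos {q : ℕ} (hq : 1 < q) : 0 < (Fintype.card Ω : ℝ) * Real.log q :=
  mul_pos (by exact_mod_cast Fintype.card_pos) (Real.log_pos (by exact_mod_cast hq))

/-- The conditional entropy averages nonnegative logarithms of ratios of nested fibres, so it
vanishes exactly when these fibres coincide. -/
lemma condEntropy_eq_zero_iff [Fintype α] [Fintype β] {q : ℕ} (hq : 1 < q)
    (X : Ω → α) (Y : Ω → β) :
    condEntropy q X Y = 0 ↔ ∀ ω ω', Y ω = Y ω' → X ω = X ω' := by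
  classical
  have hpos := fun ω => fiberCard_pos (fun ω => (X ω, Y ω)) ω
  rw [condEntropy_eq, div_eq_zero_iff, or_iff_left (card_mul_log_pos hq).ne',
    Finset.sum_eq_zero_iff_of_nonneg]
  · constructor
    · intro h ω ω' hY
      have h1 := h ω (Finset.mem_univ _)
      have h2 : fiberCard Y (Y ω) = fiberCard (fun ω => (X ω, Y ω)) (X ω, Y ω) := by
        have := Real.log_injOn_pos (by simpa using fiberCard_pos Y ω) (by simpa using hpos ω)
          (sub_eq_zero.1 h1)
        exact_mod_cast this
      have hsub : (Finset.univ.filter fun ω₁ => (X ω₁, Y ω₁) = (X ω, Y ω)) ⊆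
          Finset.univ.filter fun ω₁ => Y ω₁ = Y ω := by
        intro ω₁; simp
      have heq := Finset.eq_of_subset_of_card_le hsub (by
        refine le_of_eq ?_
        unfold fiberCard at h2
        convert h2)
      have : ω' ∈ Finset.univ.filter fun ω₁ => (X ω₁, Y ω₁) = (X ω, Y ω) := by
        rw [heq]; simp [hY]
      simp only [Finset.mem_filter, Finset.mem_univ, true_and, Prod.mk.injEq] at this
      exact this.1.symm
    · intro h ω _
      have : fiberCard Y (Y ω) = fiberCard (fun ω => (X ω, Y ω)) (X ω, Y ω) := by
        unfold fiberCard
        congr 1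
        ext ω'
        simp only [Finset.mem_filter, Finset.mem_univ, true_and, Prod.mk.injEq]
        exact ⟨fun hY => ⟨h _ _ hY, hY⟩, fun hY => hY.2⟩
      rw [this, sub_self]
  · intro ω _
    exact sub_nonneg.2 (Real.log_le_log (by exact_mod_cast hpos ω)
      (by exact_mod_cast fiberCard_prod_le X Y _ _))

lemma condMutualInfo_eq_zero_of_fiberCard [Fintype α] [Fintype β] [Fintype γ] (q : ℕ)
    (X : Ω → α) (Y : Ω → β) (V : Ω → γ)
    (h : ∀ ω, fiberCard V (V ω) * fiberCard (fun ω => (X ω, Y ω, V ω)) (X ω, Y ω, V ω) =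
      fiberCard (fun ω => (X ω, V ω)) (X ω, V ω) * fiberCard (fun ω => (Y ω, V ω)) (Y ω, V ω)) :
    condMutualInfo q X Y V = 0 := by
  rw [condMutualInfo_eq, Finset.sum_eq_zero, zero_div]
  intro ω _
  have h1 := fun {δ : Type _} (U : Ω → δ) => Nat.cast_ne_zero (R := ℝ).2 (fiberCard_pos U ω).ne'
  rw [← Real.log_mul (h1 V) (Nat.cast_ne_zero.2 (fiberCard_pos (fun ω => (X ω, Y ω, V ω)) ω).ne'),
    ← Real.log_mul (Nat.cast_ne_zero.2 (fiberCard_pos (fun ω => (X ω, V ω)) ω).ne')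
      (Nat.cast_ne_zero.2 (fiberCard_pos (fun ω => (Y ω, V ω)) ω).ne'),
    ← Nat.cast_mul, ← Nat.cast_mul, h ω, sub_self]

/-- If the conditional mutual information vanishes, then the support of the joint law of
`X`, `Y` given `V` is the product of the supports. -/
lemma exists_joint_of_condMutualInfo_eq_zero [Fintype α] [Fintype β] [Fintype γ] {q : ℕ}
    (hq : 1 < q) (X : Ω → α) (Y : Ω → β) (V : Ω → γ) (h : condMutualInfo q X Y V = 0)
    (ω₁ ω₂ : Ω) (hV : V ω₁ = V ω₂) :
    ∃ ω, X ω = X ω₁ ∧ Y ω = Y ω₂ ∧ V ω = V ω₁ := by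
  classical
  by_contra hne
  set XYV : Ω → α × β × γ := fun ω => (X ω, Y ω, V ω) with hXYV
  set XV : Ω → α × γ := fun ω => (X ω, V ω) with hXV
  set YV : Ω → β × γ := fun ω => (Y ω, V ω) with hYV
  rw [condMutualInfo_eq, div_eq_zero_iff, or_iff_left (card_mul_log_pos hq).ne'] at h
  -- `g` is the law, scaled by `|Ω|`, that makes `X` and `Y` independent given `V`. Gibbs'
  -- inequality bounds its mass on the joint support below by `|Ω|`. That is its total mass, yet the
  -- missing triple carries positive mass.
  let g : α × β × γ → ℝ := fun a =>
    (fiberCard XV (a.1, a.2.2) : ℝ) * fiberCard YV (a.2.1, a.2.2) / fiberCard V a.2.2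
  have hg : ∀ a, 0 ≤ g a := fun a => by positivity
  have hpos : ∀ ω, (0 : ℝ) < fiberCard XYV (XYV ω) := fun ω => by
    exact_mod_cast fiberCard_pos XYV ω
  have hXVp : ∀ ω, (0 : ℝ) < fiberCard XV (X ω, V ω) := fun ω => by
    exact_mod_cast fiberCard_pos XV ω
  have hYVp : ∀ ω, (0 : ℝ) < fiberCard YV (Y ω, V ω) := fun ω => by
    exact_mod_cast fiberCard_pos YV ω
  have hVp : ∀ ω, (0 : ℝ) < fiberCard V (V ω) := fun ω => by
    exact_mod_cast fiberCard_pos V ω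
  -- Gibbs' inequality on the support
  have hlow : (Fintype.card Ω : ℝ) ≤ ∑ ω, g (XYV ω) / fiberCard XYV (XYV ω) := by
    have : ∀ ω, 1 - ((Real.log (fiberCard V (V ω)) + Real.log (fiberCard XYV (X ω, Y ω, V ω))) -
        (Real.log (fiberCard XV (X ω, V ω)) + Real.log (fiberCard YV (Y ω, V ω)))) ≤
        g (XYV ω) / fiberCard XYV (XYV ω) := by
      intro ω
      have hgp : 0 < g (XYV ω) / fiberCard XYV (XYV ω) :=
        div_pos (div_pos (mul_pos (hXVp ω) (hYVp ω)) (hVp ω)) (hpos ω)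
      have hl := Real.log_le_sub_one_of_pos hgp
      have : Real.log (g (XYV ω) / fiberCard XYV (XYV ω)) =
          Real.log (fiberCard XV (X ω, V ω)) + Real.log (fiberCard YV (Y ω, V ω)) -
            Real.log (fiberCard V (V ω)) - Real.log (fiberCard XYV (X ω, Y ω, V ω)) := by
        have h1 : g (XYV ω) = (fiberCard XV (X ω, V ω) : ℝ) * fiberCard YV (Y ω, V ω) /
          fiberCard V (V ω) := rfl
        rw [h1, Real.log_div (div_pos (mul_pos (hXVp ω) (hYVp ω)) (hVp ω)).ne' (hpos ω).ne',
          Real.log_div (mul_pos (hXVp ω) (hYVp ω)).ne' (hVp ω).ne',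
          Real.log_mul (hXVp ω).ne' (hYVp ω).ne']
      linarith
    have hs := Finset.sum_le_sum fun ω (_ : ω ∈ Finset.univ) => this ω
    rw [Finset.sum_sub_distrib, h] at hs
    simpa using hs
  -- the same sum over the values of the triple
  have hsum : ∑ ω, g (XYV ω) / fiberCard XYV (XYV ω) < ∑ a, g a := by
    rw [← sum_fiberCard_mul XYV (fun a => g a / fiberCard XYV a)]
    refine Finset.sum_lt_sum (fun a _ => ?_) ⟨(X ω₁, Y ω₂, V ω₁), Finset.mem_univ _, ?_⟩
    · rcases Nat.eq_zero_or_pos (fiberCard XYV a) with h0 | h0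
      · simpa [h0] using hg a
      · rw [mul_div_cancel₀]
        exact_mod_cast h0.ne'
    · have h0 : fiberCard XYV (X ω₁, Y ω₂, V ω₁) = 0 := by
        by_contra h0
        obtain ⟨ω, hω⟩ := exists_of_fiberCard_pos (Nat.pos_of_ne_zero h0)
        simp only [hXYV, Prod.mk.injEq] at hω
        exact hne ⟨ω, hω⟩
      rw [h0]
      have : 0 < g (X ω₁, Y ω₂, V ω₁) := by
        refine div_pos (mul_pos (hXVp ω₁) ?_) (hVp ω₁)
        change (0 : ℝ) < fiberCard YV (Y ω₂, V ω₁)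
        rw [hV]
        exact hYVp ω₂
      simpa using this
  have htot : ∑ a, g a = Fintype.card Ω := by
    have h1 : ∀ v, ∑ x, ∑ y, g (x, y, v) = fiberCard V v := by
      intro v
      have hx : ∑ x, (fiberCard XV (x, v) : ℝ) = fiberCard V v := by
        exact_mod_cast sum_fiberCard_prod_left X V v
      have hy : ∑ y, (fiberCard YV (y, v) : ℝ) = fiberCard V v := by
        exact_mod_cast sum_fiberCard_prod_left Y V v
      simp only [g]
      simp_rw [← Finset.sum_div, ← Finset.mul_sum, hy, ← Finset.sum_mul, hx]
      -- This also covers an empty fibre, as `0 * 0 / 0 = 0`.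
      exact mul_self_div_self _
    rw [Fintype.sum_prod_type]
    simp_rw [Fintype.sum_prod_type]
    rw [Finset.sum_congr rfl fun x _ => Finset.sum_comm, Finset.sum_comm,
      Finset.sum_congr rfl fun v _ => h1 v]
    simpa using sum_fiberCard_mul V (fun _ => (1 : ℝ))
  linarith

end EntropyCount

/-! ### Converse bounds on message and key length. -/

section Converse

lemma eq_of_sum_update_eq {F : Type*} [Field F] {K L : ℕ} (k : Fin K) (W : Fin K → Fin L → F) (w w' : Fin L → F)
    (h : ∑ i, Function.update W k w i = ∑ i, Function.update W k w' i) : w = w' := by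
  rw [Finset.sum_update_of_mem (Finset.mem_univ _), Finset.sum_update_of_mem (Finset.mem_univ _)]
    at h
  exact add_right_cancel h

lemma message_mk {F : Type*} {K G L LX LS : ℕ} (c : Scheme F K G L LX LS) (k : Fin K)
    (W : Fin K → Fin L → F) (S : Group K G → Fin LS → F) :
    message c k (W, S) = c k (W k) fun A => S A.1 := rfl

variable {F : Type*} [Field F] [Fintype F] {K G L LX LS : ℕ}

lemma IsCorrect.inputSum_eq {c : Scheme F K G L LX LS} (hc : IsCorrect c)
    {ω ω' : Sample F K G L LS} (h : ∀ k, message c k ω = message c k ω') :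
    inputSum ω = inputSum ω' :=
  (condEntropy_eq_zero_iff Fintype.one_lt_card _ _).1 hc ω ω' (funext h)

/-- The support form of security, and the only one the converse needs: inputs and colluder keys from
`ω₁`, messages from `ω₂`. -/
lemma IsSecure.exists_sample {T : ℕ} {c : Scheme F K G L LX LS} (hc : IsSecure T c)
    {C : Finset (Fin K)} (hC : C.card ≤ T) (ω₁ ω₂ : Sample F K G L LS)
    (hsum : inputSum ω₁ = inputSum ω₂)
    (hin : ∀ k ∈ C, input k ω₁ = input k ω₂) (hkey : ∀ k ∈ C, userKey k ω₁ = userKey k ω₂) :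
    ∃ ω : Sample F K G L LS, (∀ k, input k ω = input k ω₁) ∧
      (∀ k, message c k ω = message c k ω₂) ∧ ∀ k ∈ C, userKey k ω = userKey k ω₁ := by
  obtain ⟨ω, h1, h2, h3⟩ := exists_joint_of_condMutualInfo_eq_zero Fintype.one_lt_card _ _ _
    (hc C hC) ω₁ ω₂ (by
      refine Prod.ext hsum (funext fun k => Prod.ext (hin k.1 k.2) (hkey k.1 k.2)))
  refine ⟨ω, fun k => congrFun h1 k, fun k => congrFun h2 k, fun k hk => ?_⟩
  exact congrArg Prod.snd (congrFun (congrArg Prod.snd h3) ⟨k, hk⟩)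

/-- For a fixed key, the message of a user determines the input of that user. -/
lemma IsCorrect.encoder_injective {c : Scheme F K G L LX LS} (hc : IsCorrect c) (k : Fin K)
    (z : UserKey F K G LS k) : Function.Injective fun w => c k w z := by
  classical
  intro w w' h
  let S : Group K G → Fin LS → F := fun A => if hA : k ∈ A.1 then z ⟨A, hA⟩ else 0
  have hS : (fun A : GroupOf K G k => S A.1) = z := by
    funext A
    simp [S, A.2]
  refine eq_of_sum_update_eq k 0 w w' (hc.inputSum_eq (ω := (Function.update 0 k w, S))
    (ω' := (Function.update 0 k w', S)) fun i => ?_)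
  by_cases hi : i = k
  · subst hi
    simp only [message_mk, Function.update_self, hS]
    exact h
  · simp only [message_mk, Function.update_of_ne hi]

/-- Without shared keys, the message of a user determines the input of that user. -/
lemma IsCorrect.eq_of_encoder_eq_of_one {c : Scheme F K 1 L LX LS} (hc : IsCorrect c) (k : Fin K)
    {w w' : Fin L → F} {z z' : UserKey F K 1 LS k} (h : c k w z = c k w' z') : w = w' := by
  classical
  let S : UserKey F K 1 LS k → Group K 1 → Fin LS → F :=
    fun z A => if hA : k ∈ A.1 then z ⟨A, hA⟩ else 0
  have hS : ∀ z, (fun A : GroupOf K 1 k => S z A.1) = z := by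
    intro z
    funext A
    simp [S, A.2]
  refine eq_of_sum_update_eq k 0 w w' (hc.inputSum_eq (ω := (Function.update 0 k w, S z))
    (ω' := (Function.update 0 k w', S z')) fun i => ?_)
  by_cases hi : i = k
  · subst hi
    simp only [message_mk, Function.update_self, hS]
    exact h
  -- The only group containing `k` is `{k}`, so changing its key does not affect user `i`.
  · have : ∀ z, (fun A : GroupOf K 1 i => S z A.1) = fun _ => 0 := by
      intro z
      funext A
      have hk : k ∉ A.1.1 := by
        obtain ⟨a, ha⟩ := Finset.card_eq_one.1 A.1.2
        have := A.2
        rw [ha, Finset.mem_singleton] at this ⊢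
        rw [← this]
        exact fun h => hi h.symm
      simp [S, hk]
    simp only [message_mk, Function.update_of_ne hi, this]

lemma IsCorrect.length_le {c : Scheme F K G L LX LS} (hc : IsCorrect c) (k : Fin K) : L ≤ LX := by
  have := Fintype.card_le_of_injective _ (hc.encoder_injective k (fun _ _ => 0))
  simp only [Fintype.card_fun, Fintype.card_fin] at this
  exact (Nat.pow_le_pow_iff_right Fintype.one_lt_card).1 this

/-- No secure summation scheme exists if all keys are private. -/
lemma not_isSecure_of_one (hK : 2 ≤ K) (hL : 0 < L) {T : ℕ} {c : Scheme F K 1 L LX LS}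
    (hc : IsCorrect c) : ¬ IsSecure T c := by
  classical
  intro hs
  let i : Fin K := ⟨0, by omega⟩
  let j : Fin K := ⟨1, by omega⟩
  have hij : i ≠ j := by simp [i, j]
  -- Zero sum, like the zero input, but nonzero at user `i`.
  let W : Fin K → Fin L → F := Pi.single i 1 + Pi.single j (-1)
  obtain ⟨ω, h1, h2, -⟩ := hs.exists_sample (C := ∅) (by simp) (0, 0) (W, 0)
    (by simp [inputSum, input, W, Finset.sum_add_distrib]) (by simp) (by simp)
  have := hc.eq_of_encoder_eq_of_one i (h2 i)
  rw [h1 i] at this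
  have h3 := congrFun this ⟨0, hL⟩
  simp [input, W, hij] at h3

lemma card_groups_disjoint (C : Finset (Fin K)) :
    Fintype.card {A : Group K G // Disjoint A.1 C} = (K - C.card).choose G := by
  classical
  have h : (K - C.card).choose G = ((Cᶜ).powersetCard G).card := by
    rw [Finset.card_powersetCard, Finset.card_compl, Fintype.card_fin]
  rw [h, ← Fintype.card_coe]
  refine Fintype.card_congr ⟨fun A => ⟨A.1.1, ?_⟩, fun A => ⟨⟨A.1, ?_⟩, ?_⟩, fun _ => rfl,
    fun _ => rfl⟩
  · exact Finset.mem_powersetCard.2 ⟨Finset.subset_compl_iff_disjoint_right.2 A.2, A.1.2⟩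
  · exact (Finset.mem_powersetCard.1 A.2).2
  · exact Finset.subset_compl_iff_disjoint_right.1 (Finset.mem_powersetCard.1 A.2).1

/-- The converse bound: the keys unknown to `T` colluding users must be able to mask the inputs of
the other users up to their sum. -/
lemma key_length_le {T : ℕ} (hT : T < K) {c : Scheme F K G L LX LS} (hc : IsCorrect c)
    (hs : IsSecure T c) : (K - T - 1) * L ≤ (K - T).choose G * LS := by
  classical
  obtain ⟨C, -, hC⟩ := Finset.exists_subset_card_eq (s := (Finset.univ : Finset (Fin K)))
    (n := T) (by simpa using hT.le)
  obtain ⟨r, hr⟩ : ∃ r, r ∉ C := by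
    by_contra! h
    rw [Finset.eq_univ_of_forall h] at hC
    simp at hC
    omega
  let D := {k : Fin K // k ∉ insert r C}
  have hD : Fintype.card D = K - T - 1 := by
    simp only [D, Fintype.card_subtype_compl, Fintype.card_fin, Fintype.card_coe]
    rw [Finset.card_insert_of_notMem hr, hC]
    omega
  -- User `r` balances the free inputs `d`, so that the sum is zero.
  let W : (D → Fin L → F) → Fin K → Fin L → F := fun d k =>
    if h : k ∉ insert r C then d ⟨k, h⟩ else if k = r then - ∑ i, d i else 0
  have hWC : ∀ d, ∀ k ∈ C, W d k = 0 := by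
    intro d k hk
    have : k ≠ r := fun h => hr (h ▸ hk)
    simp [W, hk, this]
  have hWsum : ∀ d, ∑ k, W d k = 0 := by
    intro d
    rw [← Finset.sum_compl_add_sum (insert r C), Finset.sum_insert hr,
      Finset.sum_eq_zero (hWC d), add_zero]
    have h1 : W d r = - ∑ i, d i := by simp [W]
    have h2 : ∑ k ∈ (insert r C)ᶜ, W d k = ∑ i, d i := by
      rw [Finset.sum_subtype (p := fun k => k ∉ insert r C) _ (by simp)]
      refine Finset.sum_congr rfl fun k _ => ?_
      simp only [W, k.2, not_false_eq_true, dite_true]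
    rw [h1, h2, add_neg_cancel]
  have hex : ∀ d, ∃ S : Group K G → Fin LS → F,
      (∀ k, message c k ((0, S) : Sample F K G L LS) = message c k (W d, 0)) ∧
      ∀ A : Group K G, ¬ Disjoint A.1 C → S A = 0 := by
    intro d
    obtain ⟨ω, h1, h2, h3⟩ := hs.exists_sample hC.le ((0, 0) : Sample F K G L LS) (W d, 0)
      (by simp [inputSum, input, hWsum]) (fun k hk => by simp [input, hWC d k hk]) (by
        intro k _; rfl)
    have hω : ω = (0, ω.2) := Prod.ext (funext h1) rfl
    refine ⟨ω.2, ?_, ?_⟩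
    · rw [← hω]; exact h2
    · intro A hA
      obtain ⟨k, hkA, hkC⟩ := Finset.not_disjoint_iff.1 hA
      exact congrFun (h3 k hkC) ⟨A, hkA⟩
  choose S hS hS0 using hex
  -- `S d` fixes the messages of `(W d, 0)`, and these determine `W d` because the key is fixed at
  -- zero.
  have hinj : Function.Injective fun (d : D → Fin L → F)
      (A : {A : Group K G // Disjoint A.1 C}) => S d A.1 := by
    intro d d' h
    have hSS : S d = S d' := by
      funext A
      by_cases hA : Disjoint A.1 C
      · exact congrFun h ⟨A, hA⟩
      · rw [hS0 d A hA, hS0 d' A hA]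
    have hW : ∀ k, W d k = W d' k := by
      intro k
      have := (hS d k).symm.trans ((by rw [hSS] :
        message c k ((0, S d) : Sample F K G L LS) = message c k (0, S d')).trans (hS d' k))
      exact hc.encoder_injective k _ this
    funext k
    have := hW k.1
    simp only [W, k.2, not_false_eq_true, dite_true] at this
    exact this
  have := Fintype.card_le_of_injective _ hinj
  simp only [Fintype.card_fun, Fintype.card_fin] at this
  rw [card_groups_disjoint, hD, hC, ← pow_mul, ← pow_mul,
    Nat.pow_le_pow_iff_right Fintype.one_lt_card] at this
  linarith [mul_comm L (K - T - 1), mul_comm LS ((K - T).choose G)]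

end Converse

/-! ### Mutual information of linear maps. -/

section LinearVariables

variable {F M N₁ N₂ N₃ : Type*} [Field F] [Fintype F] [AddCommGroup M] [Module F M] [Fintype M]
  [AddCommGroup N₁] [Module F N₁] [AddCommGroup N₂] [Module F N₂]
  [AddCommGroup N₃] [Module F N₃]

lemma fiberCard_linearMap (f : M →ₗ[F] N₁) (ω : M) :
    fiberCard f (f ω) = Fintype.card F ^ Module.finrank F (LinearMap.ker f) := by
  classical
  rw [← Module.card_eq_pow_finrank (K := F) (V := LinearMap.ker f), fiberCard,
    ← Fintype.card_coe]
  refine Fintype.card_congr ⟨fun x => ⟨x.1 - ω, ?_⟩, fun x => ⟨x.1 + ω, ?_⟩, fun x => ?_,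
    fun x => ?_⟩
  · have := (Finset.mem_filter.1 x.2).2
    simp [this]
  · have := x.2
    rw [LinearMap.mem_ker] at this
    simp [this]
  · simp
  · simp

/-- Nonempty fibres are cosets of kernels, so the required identity of counts is the dimension
formula for a sum and an intersection of subspaces. -/
lemma condMutualInfo_linearMap_eq_zero [Fintype N₁] [Fintype N₂] [Fintype N₃] (q : ℕ)
    (X : M →ₗ[F] N₁) (Y : M →ₗ[F] N₂) (V : M →ₗ[F] N₃)
    (h : LinearMap.ker V ≤ LinearMap.ker (X.prod V) ⊔ LinearMap.ker (Y.prod V)) :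
    condMutualInfo q X Y V = 0 := by
  have : Module.Finite F M := Module.Finite.of_finite
  refine condMutualInfo_eq_zero_of_fiberCard q X Y V fun ω => ?_
  have h1 := fiberCard_linearMap V ω
  have h2 := fiberCard_linearMap (X.prod (Y.prod V)) ω
  have h3 := fiberCard_linearMap (X.prod V) ω
  have h4 := fiberCard_linearMap (Y.prod V) ω
  have hsup : LinearMap.ker (X.prod V) ⊔ LinearMap.ker (Y.prod V) = LinearMap.ker V := by
    refine le_antisymm (sup_le ?_ ?_) h <;> rw [LinearMap.ker_prod] <;> exact inf_le_right
  have hinf : LinearMap.ker (X.prod V) ⊓ LinearMap.ker (Y.prod V) =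
      LinearMap.ker (X.prod (Y.prod V)) := by
    simp only [LinearMap.ker_prod]
    ext x
    simp only [Submodule.mem_inf]
    tauto
  have hrank := Submodule.finrank_sup_add_finrank_inf_eq (LinearMap.ker (X.prod V))
    (LinearMap.ker (Y.prod V))
  rw [hsup, hinf] at hrank
  change fiberCard V (V ω) * fiberCard (X.prod (Y.prod V)) (X.prod (Y.prod V) ω) =
    fiberCard (X.prod V) (X.prod V ω) * fiberCard (Y.prod V) (Y.prod V ω)
  rw [h1, h2, h3, h4, ← pow_add, ← pow_add, hrank]

end LinearVariables

/-! ### Linear masking schemes. -/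

section LinearScheme

variable {F : Type*} [Field F] {K G L LS : ℕ}

/-- The scheme in which every user masks the input by linear images of the keys. -/
def linearScheme (h : Fin K → Group K G → (Fin LS → F) →ₗ[F] (Fin L → F)) :
    Scheme F K G L L LS :=
  fun k w z => w + ∑ A : GroupOf K G k, h k A.1 (z A)

lemma message_linearScheme {h : Fin K → Group K G → (Fin LS → F) →ₗ[F] (Fin L → F)}
    (hsupp : ∀ k A, k ∉ A.1 → h k A = 0) (k : Fin K) (ω : Sample F K G L LS) :
    message (linearScheme h) k ω = ω.1 k + ∑ A, h k A (ω.2 A) := by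
  classical
  have h1 : ∑ A, h k A (ω.2 A) = ∑ A ∈ Finset.univ.filter (fun A : Group K G => k ∈ A.1),
      h k A (ω.2 A) := by
    rw [Finset.sum_filter]
    refine Finset.sum_congr rfl fun A _ => ?_
    split_ifs with hA
    · rfl
    · rw [hsupp k A hA, LinearMap.zero_apply]
  rw [h1, Finset.sum_subtype (p := fun A : Group K G => k ∈ A.1) _ (by simp)]
  rfl

/-- The inputs as a linear map. -/
def inputLinear (F : Type*) [Field F] (K G L LS : ℕ) :
    Sample F K G L LS →ₗ[F] (Fin K → Fin L → F) := LinearMap.fst F _ _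

/-- The messages of a linear scheme as a linear map. -/
def messageLinear (h : Fin K → Group K G → (Fin LS → F) →ₗ[F] (Fin L → F)) :
    Sample F K G L LS →ₗ[F] (Fin K → Fin L → F) where
  toFun ω k := ω.1 k + ∑ A, h k A (ω.2 A)
  map_add' ω ω' := by
    funext k
    simp only [Prod.fst_add, Prod.snd_add, Pi.add_apply, map_add, Finset.sum_add_distrib]
    abel
  map_smul' a ω := by
    funext k
    simp [Finset.smul_sum]

/-- The sum of the inputs and the data of the users in `C` as a linear map. -/
def colludersLinear (F : Type*) [Field F] (K G L LS : ℕ) (C : Finset (Fin K)) :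
    Sample F K G L LS →ₗ[F]
      (Fin L → F) × ((k : {k // k ∈ C}) → (Fin L → F) × UserKey F K G LS k.1) :=
  LinearMap.prod (∑ k, LinearMap.proj k ∘ₗ LinearMap.fst F _ _)
    (LinearMap.pi fun k => LinearMap.prod (LinearMap.proj k.1 ∘ₗ LinearMap.fst F _ _)
      (LinearMap.pi fun A => LinearMap.proj A.1 ∘ₗ LinearMap.snd F _ _))

variable [Fintype F]

lemma isCorrect_linearScheme {h : Fin K → Group K G → (Fin LS → F) →ₗ[F] (Fin L → F)}
    (hsupp : ∀ k A, k ∉ A.1 → h k A = 0) (hsum : ∀ A, ∑ k, h k A = 0) :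
    IsCorrect (linearScheme h) := by
  refine (condEntropy_eq_zero_iff Fintype.one_lt_card _ _).2 fun ω ω' hω => ?_
  have key : ∀ ω : Sample F K G L LS, inputSum ω = ∑ k, message (linearScheme h) k ω := by
    intro ω
    simp_rw [message_linearScheme hsupp, Finset.sum_add_distrib]
    rw [Finset.sum_comm]
    have : ∀ A, ∑ k, h k A (ω.2 A) = 0 := fun A => by
      rw [← LinearMap.sum_apply, hsum, LinearMap.zero_apply]
    simp [this, inputSum, input]
  rw [key, key]
  exact Finset.sum_congr rfl fun k _ => congrFun hω k

/-- Let `ω` have zero sum and zero colluder data, and let the keys `S` produce the masks `-ω.1`.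
Then `ω = (0, ω.2 - S) + (ω.1, S)`: the first part has zero inputs, the second zero messages, and
both keep the colluder data zero. -/
lemma isSecure_linearScheme {T : ℕ} {h : Fin K → Group K G → (Fin LS → F) →ₗ[F] (Fin L → F)}
    (hsupp : ∀ k A, k ∉ A.1 → h k A = 0)
    (hsurj : ∀ C : Finset (Fin K), C.card ≤ T → ∀ y : Fin K → Fin L → F, (∀ k ∈ C, y k = 0) →
      ∑ k, y k = 0 → ∃ S : Group K G → Fin LS → F, (∀ A, ¬ Disjoint A.1 C → S A = 0) ∧
        ∀ k, ∑ A, h k A (S A) = y k) :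
    IsSecure T (linearScheme h) := by
  intro C hC
  have hX : (fun (ω : Sample F K G L LS) (k : Fin K) => input k ω) = inputLinear F K G L LS := rfl
  have hY : (fun (ω : Sample F K G L LS) (k : Fin K) => message (linearScheme h) k ω) =
      messageLinear h := by
    funext ω k
    exact message_linearScheme hsupp k ω
  have hV : (fun ω : Sample F K G L LS =>
      (inputSum ω, fun k : {k // k ∈ C} => (input k.1 ω, userKey k.1 ω))) =
      colludersLinear F K G L LS C := by
    funext ω
    refine Prod.ext ?_ rfl
    simp [colludersLinear, inputSum, input]
  rw [hX, hY, hV]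
  refine condMutualInfo_linearMap_eq_zero _ _ _ _ fun ω hω => ?_
  have hVω : colludersLinear F K G L LS C ω = 0 := hω
  have hVmem : ∀ ω : Sample F K G L LS, colludersLinear F K G L LS C ω = 0 ↔
      ∑ k, ω.1 k = 0 ∧ ∀ k ∈ C, ω.1 k = 0 ∧ ∀ A : Group K G, k ∈ A.1 → ω.2 A = 0 := by
    intro ω
    rw [← hV, Prod.ext_iff]
    refine and_congr Iff.rfl ⟨fun h0 k hk => ?_, fun h0 => ?_⟩
    · have := congrFun h0 ⟨k, hk⟩
      exact ⟨congrArg Prod.fst this, fun A hA => congrFun (congrArg Prod.snd this) ⟨A, hA⟩⟩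
    · funext k
      exact Prod.ext (h0 k.1 k.2).1 (funext fun A => (h0 k.1 k.2).2 A.1 A.2)
  obtain ⟨h1, h2⟩ := (hVmem ω).1 hVω
  obtain ⟨S, hS0, hS⟩ := hsurj C hC (fun k => - ω.1 k) (fun k hk => by rw [(h2 k hk).1, neg_zero])
    (by rw [Finset.sum_neg_distrib, h1, neg_zero])
  have hSC : ∀ k ∈ C, ∀ A : Group K G, k ∈ A.1 → S A = 0 := fun k hk A hA =>
    hS0 A (Finset.not_disjoint_iff.2 ⟨k, hA, hk⟩)
  refine Submodule.mem_sup.2 ⟨(0, ω.2 - S), ?_, (ω.1, S), ?_, by simp⟩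
  · rw [LinearMap.ker_prod, Submodule.mem_inf]
    refine ⟨rfl, (hVmem _).2 ⟨by simp, fun k hk => ⟨rfl, fun A hA => ?_⟩⟩⟩
    simp [hSC k hk A hA, (h2 k hk).2 A hA]
  · rw [LinearMap.ker_prod, Submodule.mem_inf]
    refine ⟨?_, (hVmem _).2 ⟨h1, fun k hk => ⟨(h2 k hk).1, hSC k hk⟩⟩⟩
    rw [LinearMap.mem_ker, ← hY]
    funext k
    simp [message_linearScheme hsupp, hS]

end LinearScheme

universe u

/-! ### Generic choice of coefficients. -/

section Generic

open MvPolynomial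

/-- Finitely many matrices with polynomial entries, each of which is right invertible at some
point, are simultaneously right invertible at a point over a finite extension field. -/
lemma exists_common_right_inverse {F : Type u} [Field F] {ι P : Type*} [Finite ι] [Finite P]
    {m n : ι → Type*} [∀ i, Fintype (m i)] [∀ i, DecidableEq (m i)]
    [∀ i, Fintype (n i)] (M : ∀ i, Matrix (m i) (n i) (MvPolynomial P F))
    (h : ∀ i, ∃ (y : P → F) (B : Matrix (n i) (m i) F), (M i).map (eval y) * B = 1) :
    ∃ (E : Type u) (_ : Field E) (_ : Algebra F E), Module.Finite F E ∧ ∃ y : P → E,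
      ∀ i, ∃ B : Matrix (n i) (m i) E, (M i).map (aeval y) * B = 1 := by
  classical
  have := Fintype.ofFinite ι
  choose y B hB using h
  -- Keeping `B i` constant turns invertibility into the nonvanishing of one polynomial, whose value
  -- at `y i` is `1`.
  let p : ι → MvPolynomial P F := fun i => Matrix.det
    (M i * ((B i).map C : Matrix (n i) (m i) (MvPolynomial P F)) :
      Matrix (m i) (m i) (MvPolynomial P F))
  have hp : ∀ i, p i ≠ 0 := by
    intro i h0
    have h1 : eval (y i) (p i) = 1 := by
      simp only [p]
      rw [RingHom.map_det, RingHom.mapMatrix_apply, Matrix.map_mul, Matrix.map_map]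
      have : (B i).map (eval (y i) ∘ C) = B i := by
        ext a b; simp
      rw [this, hB i, Matrix.det_one]
    rw [h0, map_zero] at h1
    exact zero_ne_one h1
  have hprod : ∏ i, p i ≠ 0 := Finset.prod_ne_zero_iff.2 fun i _ => hp i
  -- `F` may be too small for a nonzero of the product; its algebraic closure is infinite, and the
  -- finitely many coordinates of `z` generate a finite extension.
  obtain ⟨z, hz⟩ : ∃ z : P → AlgebraicClosure F, aeval z (∏ i, p i) ≠ 0 := by
    by_contra! h0
    refine hprod (map_injective (algebraMap F (AlgebraicClosure F))
      (algebraMap F (AlgebraicClosure F)).injective ?_)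
    rw [map_zero]
    refine MvPolynomial.funext fun z => ?_
    rw [map_zero, eval_map, ← aeval_def, h0 z]
  let E := IntermediateField.adjoin F (Set.range z)
  have hE : FiniteDimensional F E :=
    IntermediateField.finiteDimensional_adjoin fun x _ => Algebra.IsIntegral.isIntegral x
  refine ⟨E, inferInstance, inferInstance, hE,
    fun a => ⟨z a, IntermediateField.subset_adjoin F _ ⟨a, rfl⟩⟩, fun i => ?_⟩
  set y' : P → E := fun a => ⟨z a, IntermediateField.subset_adjoin F _ ⟨a, rfl⟩⟩
  have hi : aeval y' (p i) ≠ 0 := by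
    intro h0
    refine hz ?_
    have h1 : aeval z (p i) = algebraMap E (AlgebraicClosure F) (aeval y' (p i)) := by
      rw [← aeval_algebraMap_apply]
      rfl
    rw [map_prod, Finset.prod_eq_zero (Finset.mem_univ i)]
    rw [h1, h0, map_zero]
  have hdet : aeval y' (p i) = ((M i).map (aeval y') * (B i).map (algebraMap F E)).det := by
    simp only [p]
    rw [AlgHom.map_det, AlgHom.mapMatrix_apply, Matrix.map_mul, Matrix.map_map]
    congr 2
    ext a b
    simp
  rw [hdet] at hi
  exact ⟨(B i).map (algebraMap F E) * ((M i).map (aeval y') * (B i).map (algebraMap F E))⁻¹, by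
    rw [← Matrix.mul_assoc, Matrix.mul_nonsing_inv _ (isUnit_iff_ne_zero.2 hi)]⟩

end Generic

/-! ### Counting permutations between two sets. -/

section Slots

/-- The permutations that send a given finset to another given one can be numbered by
`G! * (N - G)!` slots. -/
lemma exists_slot {N G : ℕ} (B : Finset (Fin N)) (hB : B.card = G) :
    ∃ slot : Equiv.Perm (Fin N) → Fin (G.factorial * (N - G).factorial),
      ∀ p p' : Equiv.Perm (Fin N), B.map p.toEmbedding = B.map p'.toEmbedding →
        slot p = slot p' → p = p' := by
  classical
  have hle : ∀ A : Finset (Fin N),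
      Fintype.card {p : Equiv.Perm (Fin N) // B.map p.toEmbedding = A} ≤
        Fintype.card (Fin (G.factorial * (N - G).factorial)) := by
    intro A
    rw [Fintype.card_fin]
    have hmem : ∀ p : {p : Equiv.Perm (Fin N) // B.map p.toEmbedding = A}, ∀ x,
        x ∈ B ↔ p.1 x ∈ A := by
      rintro ⟨p, rfl⟩ x
      simp
    -- Such a permutation splits into bijections `B ≃ A` and between the complements.
    let f : {p : Equiv.Perm (Fin N) // B.map p.toEmbedding = A} →
        ({x // x ∈ B} ≃ {x // x ∈ A}) × ({x // x ∉ B} ≃ {x // x ∉ A}) := fun p =>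
      (p.1.subtypeEquiv (hmem p), p.1.subtypeEquiv fun x => not_congr (hmem p x))
    have hf : Function.Injective f := by
      intro p p' h
      refine Subtype.ext (Equiv.ext fun x => ?_)
      by_cases hx : x ∈ B
      · exact congrArg Subtype.val (DFunLike.congr_fun (congrArg Prod.fst h) ⟨x, hx⟩)
      · exact congrArg Subtype.val (DFunLike.congr_fun (congrArg Prod.snd h) ⟨x, hx⟩)
    refine (Fintype.card_le_of_injective f hf).trans ?_
    rw [Fintype.card_prod]
    refine Nat.mul_le_mul ?_ ?_
    · rcases isEmpty_or_nonempty ({x // x ∈ B} ≃ {x // x ∈ A}) with h | ⟨⟨e⟩⟩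
      · simp
      · rw [Fintype.card_equiv e, Fintype.card_coe, hB]
    · rcases isEmpty_or_nonempty ({x // x ∉ B} ≃ {x // x ∉ A}) with h | ⟨⟨e⟩⟩
      · simp
      · rw [Fintype.card_equiv e, Fintype.card_subtype_compl, Fintype.card_coe, hB,
          Fintype.card_fin]
  have hemb := fun A => (Function.Embedding.nonempty_of_card_le (hle A)).some
  refine ⟨fun p => hemb _ ⟨p, rfl⟩, fun p p' h hs => ?_⟩
  have hcast : ∀ A (hA : B.map p.toEmbedding = A), hemb _ ⟨p, rfl⟩ = hemb A ⟨p, hA⟩ := by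
    rintro A rfl; rfl
  replace hs := (hcast _ h).symm.trans hs
  exact congrArg Subtype.val ((hemb _).injective hs)

end Slots

/-! ### Key coefficients that cancel in the sum. -/

section KeyMatrix

variable {R S : Type*} [CommRing R] [CommRing S] {K G : ℕ} {Λ Θ : Type*}

/-- The general family of coefficient matrices with `∑ k, H k A = 0`, and with `H k A = 0` if
`k ∉ A`, parametrized by its free entries. -/
def keyMatrix (ρ : Group K G → Fin K) (Y : Fin K × Group K G × Λ × Θ → R) (k : Fin K)
    (A : Group K G) : Matrix Λ Θ R :=
  Matrix.of fun l s => if k ∈ A.1 then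
    Y (k, A, l, s) - (if k = ρ A then ∑ j ∈ A.1, Y (j, A, l, s) else 0) else 0

lemma keyMatrix_of_notMem (ρ : Group K G → Fin K) (Y : Fin K × Group K G × Λ × Θ → R) {k : Fin K}
    {A : Group K G} (h : k ∉ A.1) : keyMatrix ρ Y k A = 0 := by
  ext l s
  simp [keyMatrix, h]

lemma sum_keyMatrix {ρ : Group K G → Fin K} (hρ : ∀ A, ρ A ∈ A.1)
    (Y : Fin K × Group K G × Λ × Θ → R) (A : Group K G) : ∑ k, keyMatrix ρ Y k A = 0 := by
  ext l s
  rw [Matrix.sum_apply]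
  simp only [keyMatrix, Matrix.of_apply, Matrix.zero_apply]
  rw [← Finset.sum_filter, Finset.filter_mem_eq_inter, Finset.univ_inter,
    Finset.sum_sub_distrib, Finset.sum_ite_eq' A.1 (ρ A), if_pos (hρ A), sub_self]

/-- The coefficients with which the keys unknown to `C` enter the messages of the users outside
`C` and different from `r`. -/
def unknownKeyMatrix (ρ : Group K G → Fin K) (C : Finset (Fin K)) (r : {k // k ∉ C})
    (Y : Fin K × Group K G × Λ × Θ → R) :
    Matrix (Λ × {k // k ≠ r}) ({A : Group K G // Disjoint A.1 C} × Θ) R :=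
  Matrix.of fun i a => keyMatrix ρ Y i.2.1.1 a.1.1 i.1 a.2

lemma unknownKeyMatrix_map (f : R →+* S) (ρ : Group K G → Fin K) (C : Finset (Fin K))
    (r : {k // k ∉ C}) (Y : Fin K × Group K G × Λ × Θ → R) :
    (unknownKeyMatrix ρ C r Y).map f = unknownKeyMatrix ρ C r (f ∘ Y) := by
  ext i a
  simp only [unknownKeyMatrix, keyMatrix, Matrix.map_apply, Matrix.of_apply, Function.comp]
  split_ifs <;> simp

variable [Fintype Λ] [Fintype Θ] [DecidableEq Λ]

/-- The right inverse solves the equations outside `C` except at `r`. Those in `C` read `0 = 0`, and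
the one at `r` follows since both sides sum to zero over all users. -/
lemma exists_keys_of_right_inverse {ρ : Group K G → Fin K} (hρ : ∀ A, ρ A ∈ A.1)
    (C : Finset (Fin K)) (r : {k // k ∉ C}) (Y : Fin K × Group K G × Λ × Θ → R)
    (hY : ∃ B : Matrix ({A : Group K G // Disjoint A.1 C} × Θ) (Λ × {k // k ≠ r}) R,
      unknownKeyMatrix ρ C r Y * B = 1)
    (y : Fin K → Λ → R) (hyC : ∀ k ∈ C, y k = 0) (hy : ∑ k, y k = 0) :
    ∃ S : Group K G → Θ → R, (∀ A, ¬ Disjoint A.1 C → S A = 0) ∧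
      ∀ k, ∑ A, (keyMatrix ρ Y k A).mulVec (S A) = y k := by
  classical
  obtain ⟨B, hB⟩ := hY
  let b := B.mulVec fun i => y i.2.1.1 i.1
  have hb : (unknownKeyMatrix ρ C r Y).mulVec b = fun i => y i.2.1.1 i.1 := by
    rw [Matrix.mulVec_mulVec, hB, Matrix.one_mulVec]
  let S : Group K G → Θ → R := fun A s => if h : Disjoint A.1 C then b (⟨A, h⟩, s) else 0
  have hS : ∀ A, ¬ Disjoint A.1 C → S A = 0 := by
    intro A hA
    funext s
    simp [S, hA]
  have hout : ∀ k : {k // k ≠ r}, ∑ A, (keyMatrix ρ Y k.1.1 A).mulVec (S A) = y k.1.1 := by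
    intro k
    funext l
    rw [← congrFun hb (l, k), Finset.sum_apply]
    rw [← Finset.sum_subset (Finset.subset_univ
      (Finset.univ.filter fun A : Group K G => Disjoint A.1 C))]
    · rw [Finset.sum_subtype (p := fun A : Group K G => Disjoint A.1 C) _ (by simp)]
      simp only [Matrix.mulVec, dotProduct, Fintype.sum_prod_type]
      refine Finset.sum_congr rfl fun A _ => Finset.sum_congr rfl fun s _ => ?_
      simp [S, A.2, unknownKeyMatrix]
    · intro A _ hA
      rw [hS A (by simpa using hA), Matrix.mulVec_zero, Pi.zero_apply]
  have hin : ∀ k ∈ C, ∑ A, (keyMatrix ρ Y k A).mulVec (S A) = y k := by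
    intro k hk
    rw [hyC k hk]
    refine Finset.sum_eq_zero fun A _ => ?_
    by_cases hA : Disjoint A.1 C
    · rw [keyMatrix_of_notMem ρ Y (fun h => Finset.disjoint_left.1 hA h hk), Matrix.zero_mulVec]
    · rw [hS A hA, Matrix.mulVec_zero]
  have hsum : ∑ k, (∑ A, (keyMatrix ρ Y k A).mulVec (S A) - y k) = 0 := by
    rw [Finset.sum_sub_distrib, hy, Finset.sum_comm, sub_zero]
    refine Finset.sum_eq_zero fun A _ => ?_
    rw [← Matrix.sum_mulVec, sum_keyMatrix hρ, Matrix.zero_mulVec]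
  have hne : ∀ k, k ≠ r.1 → ∑ A, (keyMatrix ρ Y k A).mulVec (S A) = y k := by
    intro k hk
    by_cases hkC : k ∈ C
    · exact hin k hkC
    · exact hout ⟨⟨k, hkC⟩, fun h => hk (congrArg Subtype.val h)⟩
  refine ⟨S, hS, fun k => ?_⟩
  by_cases hk : k = r.1
  · rw [Finset.sum_eq_single r.1 (fun k _ hk => by rw [hne k hk, sub_self]) (by simp)] at hsum
    rw [hk]
    exact sub_eq_zero.1 hsum
  · exact hne k hk

end KeyMatrix

/-! ### The star construction for one colluding set. -/

section Star

/-- For one set `C` of colluding users there are key coefficients that mask the inputs of all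
other users: each input coordinate is masked along a star of users. -/
lemma exists_unknownKeyMatrix_right_inverse (F : Type*) [Field F] {K G n : ℕ} (hG : 2 ≤ G)
    (hGn : G ≤ n + 1) (ρ : Group K G → Fin K) (C : Finset (Fin K))
    (hC : C.card + (n + 1) = K) (r : {k // k ∉ C}) :
    ∃ (Y : Fin K × Group K G × Equiv.Perm (Fin (n + 1)) ×
          (Fin n × Fin (G.factorial * (n + 1 - G).factorial)) → F)
      (B : Matrix ({A : Group K G // Disjoint A.1 C} ×
          (Fin n × Fin (G.factorial * (n + 1 - G).factorial)))
        (Equiv.Perm (Fin (n + 1)) × {k // k ≠ r}) F), unknownKeyMatrix ρ C r Y * B = 1 := by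
  classical
  have hcard : Fintype.card (Fin (n + 1)) = Fintype.card {k // k ∉ C} := by
    rw [Fintype.card_subtype_compl, Fintype.card_coe, Fintype.card_fin, Fintype.card_fin]
    omega
  let e : Fin (n + 1) ≃ {k // k ∉ C} := Fintype.equivOfCardEq hcard
  have hB : ∀ j : Fin n, ∃ B : Finset (Fin (n + 1)), {0, j.succ} ⊆ B ∧ B.card = G := fun j =>
    Finset.exists_superset_card_eq
      ((Finset.card_le_two (a := (0 : Fin (n + 1))) (b := j.succ)).trans hG) (by simpa using hGn)
  choose B hBsub hBcard using hB
  choose slot hslot using fun j => exists_slot (B j) (hBcard j)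
  let em : Equiv.Perm (Fin (n + 1)) → Fin (n + 1) ↪ Fin K := fun p =>
    p.toEmbedding.trans (e.toEmbedding.trans (Function.Embedding.subtype _))
  -- Coordinate `l` has a star with centre `em l 0` and leaves `em l j.succ`. Each edge gets a key
  -- symbol of a group containing both ends; the slots make these symbols distinct.
  let gs : Equiv.Perm (Fin (n + 1)) × Fin n → {A : Group K G // Disjoint A.1 C} ×
      (Fin n × Fin (G.factorial * (n + 1 - G).factorial)) := fun i =>
    (⟨⟨(B i.2).map (em i.1), by rw [Finset.card_map, hBcard]⟩, by
      rw [Finset.disjoint_left]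
      intro k hk
      obtain ⟨x, -, rfl⟩ := Finset.mem_map.1 hk
      exact (e (i.1 x)).2⟩, (i.2, slot i.2 i.1))
  have hgs : Function.Injective gs := by
    rintro ⟨p, j⟩ ⟨p', j'⟩ h
    simp only [gs, Prod.mk.injEq, Subtype.mk.injEq] at h
    obtain ⟨h1, rfl, h2⟩ := h
    have h3 : (B j).map p.toEmbedding = (B j).map p'.toEmbedding := by
      simp only [em, ← Finset.map_map] at h1
      exact Finset.map_injective _ (Finset.map_injective _ h1)
    rw [hslot j p p' h3 h2]
  have hmem0 : ∀ p j, em p 0 ∈ (gs (p, j)).1.1.1 := fun p j =>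
    Finset.mem_map_of_mem _ (hBsub j (by simp))
  have hmemj : ∀ p j, em p j.succ ∈ (gs (p, j)).1.1.1 := fun p j =>
    Finset.mem_map_of_mem _ (hBsub j (by simp))
  let Y : Fin K × Group K G × Equiv.Perm (Fin (n + 1)) ×
      (Fin n × Fin (G.factorial * (n + 1 - G).factorial)) → F := fun a =>
    -- The symbol of an edge enters with `+1` at the leaf and `-1` at the centre.
    ∑ j, if (gs (a.2.2.1, j)).1.1 = a.2.1 ∧ (gs (a.2.2.1, j)).2 = a.2.2.2 then
      (if a.1 = em a.2.2.1 j.succ then 1 else 0) - (if a.1 = em a.2.2.1 0 then 1 else 0) else 0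
  have hYsum : ∀ A l s, ∑ k ∈ A.1, Y (k, A, l, s) = 0 := by
    intro A l s
    simp only [Y]
    rw [Finset.sum_comm]
    refine Finset.sum_eq_zero fun j _ => ?_
    split_ifs with h
    · rw [Finset.sum_sub_distrib, Finset.sum_ite_eq', Finset.sum_ite_eq', ← h.1,
        if_pos (hmemj l j), if_pos (hmem0 l j), sub_self]
    · simp
  have hYsupp : ∀ k A l s, k ∉ A.1 → Y (k, A, l, s) = 0 := by
    intro k A l s hk
    simp only [Y]
    refine Finset.sum_eq_zero fun j _ => ?_
    split_ifs with h h1 h2 h2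
    · exact absurd (h.1 ▸ h1 ▸ hmemj l j) hk
    · exact absurd (h.1 ▸ h1 ▸ hmemj l j) hk
    · exact absurd (h.1 ▸ h2 ▸ hmem0 l j) hk
    · simp
    · rfl
  -- `Y` already sums to zero over each group, so the correction at `ρ A` vanishes.
  have hkey : ∀ k A l s, keyMatrix ρ Y k A l s = Y (k, A, l, s) := by
    intro k A l s
    simp only [keyMatrix, Matrix.of_apply, hYsum, ite_self, sub_zero]
    split_ifs with h
    · rfl
    · exact (hYsupp k A l s h).symm
  refine ⟨Y, Matrix.mulVec_surjective_iff_exists_right_inverse.1 fun v => ?_⟩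
  -- The zero-sum extension of `v` to user `r`, who may sit anywhere in a star.
  let u : Equiv.Perm (Fin (n + 1)) → {k // k ∉ C} → F := fun l k =>
    if h : k ≠ r then v (l, ⟨k, h⟩) else - ∑ k' : {k // k ≠ r}, v (l, k')
  have hu : ∀ l, ∑ k, u l k = 0 := by
    intro l
    rw [Fintype.sum_eq_add_sum_subtype_ne _ r]
    have h1 : u l r = - ∑ k' : {k // k ≠ r}, v (l, k') := by simp [u]
    have h2 : ∀ k : {k // k ≠ r}, u l k.1 = v (l, k) := fun k => by simp [u, k.2]
    rw [h1, Finset.sum_congr rfl fun k _ => h2 k, neg_add_cancel]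
  have hu0 : ∀ l, u l (e (l 0)) = - ∑ j : Fin n, u l (e (l j.succ)) := by
    intro l
    have h1 := hu l
    rw [← (l.trans e).sum_comp, Fin.sum_univ_succ] at h1
    exact eq_neg_of_add_eq_zero_left h1
  -- Each edge symbol is the target at its leaf; the centre then receives minus the sum of the
  -- leaves, its own target.
  refine ⟨Function.extend gs (fun i => u i.1 (e (i.1 i.2.succ))) 0, ?_⟩
  set b := Function.extend gs (fun i => u i.1 (e (i.1 i.2.succ))) 0
  have hb : ∀ l j, b (gs (l, j)) = u l (e (l j.succ)) := fun l j => hgs.extend_apply _ _ _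
  funext ⟨l, k⟩
  obtain ⟨i, hi⟩ : ∃ i, e (l i) = k.1 := (l.trans e).surjective k.1
  have hem : ∀ i', k.1.1 = em l i' ↔ i = i' := by
    intro i'
    rw [← hi]
    exact (em l).injective.eq_iff (a := i) (b := i')
  have hval : v (l, k) = u l (e (l i)) := by
    rw [hi]
    simp [u, k.2]
  have hmul : (unknownKeyMatrix ρ C r Y).mulVec b (l, k) =
      ∑ j : Fin n, ((if i = j.succ then 1 else 0) - (if i = 0 then 1 else 0)) *
        u l (e (l j.succ)) := by
    have h1 : (unknownKeyMatrix ρ C r Y).mulVec b (l, k) =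
        ∑ a, ∑ j, if gs (l, j) = a then
          ((if i = j.succ then 1 else 0) - (if i = 0 then 1 else 0)) * b a else 0 := by
      simp only [Matrix.mulVec, dotProduct]
      refine Finset.sum_congr rfl fun a _ => ?_
      simp only [unknownKeyMatrix, Matrix.of_apply, hkey, Y, hem]
      rw [Finset.sum_mul]
      refine Finset.sum_congr rfl fun j _ => ?_
      rw [ite_mul, zero_mul]
      exact if_congr ⟨fun h => Prod.ext (Subtype.ext h.1) h.2, fun h => h ▸ ⟨rfl, rfl⟩⟩ rfl rfl
    rw [h1, Finset.sum_comm]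
    refine Finset.sum_congr rfl fun j _ => ?_
    rw [Finset.sum_ite_eq, if_pos (Finset.mem_univ _), hb]
  rw [hmul, hval]
  refine Fin.cases ?_ (fun j => ?_) i
  · rw [hu0]
    simp [(Fin.succ_ne_zero _).symm]
  · simp [Fin.succ_ne_zero]

end Star

/-! ### A scheme at the corner point. -/

section Achievability

/-- It suffices to mask the inputs against the largest sets of colluding users. -/
lemma exists_keys_of_card_le {F U V : Type*} [Field F] [AddCommGroup U] [Module F U]
    [AddCommGroup V] [Module F V] {K G T : ℕ} (hT : T + 2 ≤ K)
    {h : Fin K → Group K G → U →ₗ[F] V}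
    (hsurj : ∀ C : Finset (Fin K), C.card = T → ∀ y : Fin K → V, (∀ k ∈ C, y k = 0) →
      ∑ k, y k = 0 → ∃ S : Group K G → U, (∀ A, ¬ Disjoint A.1 C → S A = 0) ∧
        ∀ k, ∑ A, h k A (S A) = y k)
    (C : Finset (Fin K)) (hC : C.card ≤ T) (y : Fin K → V) (hyC : ∀ k ∈ C, y k = 0)
    (hy : ∑ k, y k = 0) : ∃ S : Group K G → U, (∀ A, ¬ Disjoint A.1 C → S A = 0) ∧
      ∀ k, ∑ A, h k A (S A) = y k := by
  classical
  obtain ⟨r, hr⟩ : ∃ r, r ∉ C := by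
    by_contra! h
    rw [Finset.eq_univ_of_forall h] at hC
    simp at hC
    omega
  -- A zero-sum `y` is a sum of transfers between `j` and `r`. Each involves at most two users, so
  -- `C` can be enlarged to size `T` avoiding them, as `T + 2 ≤ K`.
  have hex : ∀ j : Fin K, ∃ S : Group K G → U, (∀ A, ¬ Disjoint A.1 C → S A = 0) ∧
      ∀ k, ∑ A, h k A (S A) = Pi.single (M := fun _ => V) j (y j) k -
        Pi.single (M := fun _ => V) r (y j) k := by
    intro j
    by_cases hj : j ∈ C
    · exact ⟨0, fun _ _ => rfl, fun k => by simp [hyC j hj]⟩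
    · have hsub : C ⊆ ({j, r} : Finset (Fin K))ᶜ := by
        intro k hk
        simp only [Finset.mem_compl, Finset.mem_insert, Finset.mem_singleton, not_or]
        exact ⟨fun h => hj (h ▸ hk), fun h => hr (h ▸ hk)⟩
      obtain ⟨C', hCC', hC'sub, hC'⟩ := Finset.exists_subsuperset_card_eq hsub hC (by
        rw [Finset.card_compl, Fintype.card_fin]
        have := Finset.card_le_two (a := j) (b := r)
        omega)
      obtain ⟨S, hS0, hS⟩ := hsurj C' hC' (fun k => Pi.single (M := fun _ => V) j (y j) k -
        Pi.single (M := fun _ => V) r (y j) k) (fun k hk => by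
          have := hC'sub hk
          simp only [Finset.mem_compl, Finset.mem_insert, Finset.mem_singleton, not_or] at this
          simp [this.1, this.2]) (by simp [Finset.sum_sub_distrib])
      exact ⟨S, fun A hA => hS0 A fun h => hA (h.mono_right hCC'), hS⟩
  choose S hS0 hS using hex
  refine ⟨∑ j, S j, fun A hA => ?_, fun k => ?_⟩
  · rw [Finset.sum_apply]
    exact Finset.sum_eq_zero fun j _ => hS0 j A hA
  · simp only [Finset.sum_apply, map_sum]
    rw [Finset.sum_comm, Finset.sum_congr rfl fun j _ => hS j k, Finset.sum_sub_distrib,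
      Finset.sum_pi_single]
    by_cases hk : k = r
    · subst hk
      simp [hy]
    · simp [hk]

/-- Some secure summation scheme attains the corner point of the region. -/
lemma exists_scheme (F : Type*) [Field F] [Fintype F] {K T G n : ℕ} (hn : 1 ≤ n)
    (hK : T + (n + 1) = K) (hG : 2 ≤ G) (hGn : G ≤ n + 1) :
    ∃ L LS : ℕ, 0 < L ∧ n * L = (n + 1).choose G * LS ∧ ∃ c : Scheme F K G L L LS,
      IsCorrect c ∧ IsSecure T c := by
  classical
  set s := G.factorial * (n + 1 - G).factorial with hs
  let Λ := Equiv.Perm (Fin (n + 1))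
  let Θ := Fin n × Fin s
  have hne : ∀ A : Group K G, A.1.Nonempty := fun A => Finset.card_pos.1 (by rw [A.2]; omega)
  choose ρ hρ using hne
  have hout : ∀ C : {C : Finset (Fin K) // C.card = T}, ∃ r, r ∉ C.1 := by
    intro C
    by_contra! h
    have := C.2
    rw [Finset.eq_univ_of_forall h] at this
    simp at this
    omega
  choose r hr using hout
  obtain ⟨E, _, _, hE, Y, hY⟩ := exists_common_right_inverse (F := F)
    (P := Fin K × Group K G × Λ × Θ)
    (fun C : {C : Finset (Fin K) // C.card = T} =>
      unknownKeyMatrix (Λ := Λ) (Θ := Θ) ρ C.1 ⟨r C, hr C⟩ MvPolynomial.X) (by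
        intro C
        obtain ⟨y, B, hB⟩ := exists_unknownKeyMatrix_right_inverse F hG hGn ρ C.1
          (by rw [C.2, hK]) ⟨r C, hr C⟩
        refine ⟨y, B, ?_⟩
        rw [unknownKeyMatrix_map]
        have : (MvPolynomial.eval y : MvPolynomial _ F → F) ∘ MvPolynomial.X = y := by
          funext a; simp
        rw [this]
        exact hB)
  let m := Module.finrank F E
  have hm : 0 < m := Module.finrank_pos
  -- Restriction of scalars multiplies both lengths by `m`, leaving the rates unchanged.
  let φ : (Fin (Fintype.card Λ * m) → F) ≃ₗ[F] (Λ → E) := LinearEquiv.ofFinrankEq _ _ (by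
    rw [Module.finrank_fintype_fun_eq_card, Module.finrank_pi_fintype]
    simp [m])
  let ψ : (Fin (Fintype.card Θ * m) → F) ≃ₗ[F] (Θ → E) := LinearEquiv.ofFinrankEq _ _ (by
    rw [Module.finrank_fintype_fun_eq_card, Module.finrank_pi_fintype]
    simp [m])
  let h : Fin K → Group K G →
      (Fin (Fintype.card Θ * m) → F) →ₗ[F] (Fin (Fintype.card Λ * m) → F) := fun k A =>
    φ.symm.toLinearMap ∘ₗ ((keyMatrix ρ Y k A).mulVecLin.restrictScalars F) ∘ₗ ψ.toLinearMap
  have hh : ∀ k A S, h k A S = φ.symm ((keyMatrix ρ Y k A).mulVec (ψ S)) := fun _ _ _ => rfl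
  have hsupp : ∀ k A, k ∉ A.1 → h k A = 0 := by
    intro k A hk
    refine LinearMap.ext fun S => ?_
    rw [hh, keyMatrix_of_notMem ρ Y hk, Matrix.zero_mulVec, map_zero, LinearMap.zero_apply]
  refine ⟨Fintype.card Λ * m, Fintype.card Θ * m, Nat.mul_pos Fintype.card_pos hm, ?_,
    linearScheme h, isCorrect_linearScheme hsupp ?_, isSecure_linearScheme hsupp
      (exists_keys_of_card_le (by omega) ?_)⟩
  -- Up to `m`, this is `n * (n+1)! = (n+1).choose G * (n * G! * (n+1-G)!)`: the stars have as many
  -- edges as there are key symbols.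
  · simp only [Λ, Θ, Fintype.card_perm, Fintype.card_fin, Fintype.card_prod]
    rw [← Nat.choose_mul_factorial_mul_factorial hGn, hs]
    ring
  · intro A
    refine LinearMap.ext fun S => ?_
    rw [LinearMap.sum_apply, LinearMap.zero_apply]
    simp_rw [hh]
    rw [← map_sum, ← Matrix.sum_mulVec, sum_keyMatrix hρ, Matrix.zero_mulVec, map_zero]
  · intro C hC y hyC hy
    have hYC := hY ⟨C, hC⟩
    have hmap : (unknownKeyMatrix (Λ := Λ) (Θ := Θ) ρ C ⟨r ⟨C, hC⟩, hr ⟨C, hC⟩⟩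
        (MvPolynomial.X : _ → MvPolynomial (Fin K × Group K G × Λ × Θ) F)).map
          (MvPolynomial.aeval Y) = unknownKeyMatrix ρ C ⟨r ⟨C, hC⟩, hr ⟨C, hC⟩⟩ Y := by
      refine (unknownKeyMatrix_map (MvPolynomial.aeval (R := F) Y : _ →ₐ[F] E).toRingHom ρ C _ _).trans ?_
      congr 1
      funext a
      simp
    rw [hmap] at hYC
    obtain ⟨S, hS0, hS⟩ := exists_keys_of_right_inverse hρ C _ Y hYC (fun k => φ (y k))
      (fun k hk => by rw [hyC k hk, map_zero]) (by rw [← map_sum, hy, map_zero])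
    refine ⟨fun A => ψ.symm (S A), fun A hA => by simp only [hS0 A hA, map_zero],
      fun k => ?_⟩
    simp_rw [hh, LinearEquiv.apply_symm_apply]
    rw [← map_sum, hS k, LinearEquiv.symm_apply_apply]

end Achievability

/-! ### The achievable region. -/

section Region

lemma choose_cast_div_le {a b L LS : ℕ} (hL : 0 < L) (hb : 0 < b) (h : a * L ≤ b * LS) :
    (a : ℝ) / b ≤ (LS : ℝ) / L := by
  rw [div_le_div_iff₀ (by exact_mod_cast hb) (by exact_mod_cast hL)]
  exact_mod_cast (by linarith [mul_comm b LS] : a * L ≤ LS * b)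

lemma achievable_eq_empty_of_lt (F : Type*) [Field F] [Fintype F] {K T G : ℕ} (hT : T + 2 ≤ K)
    (hG : K - T < G) : achievable F K T G = ∅ := by
  refine Set.eq_empty_of_forall_notMem ?_
  rintro r ⟨L, LX, LS, hL, c, hc, hs, -⟩
  have := key_length_le (by omega) hc hs
  rw [Nat.choose_eq_zero_of_lt hG, zero_mul] at this
  have : 0 < (K - T - 1) * L := Nat.mul_pos (by omega) hL
  omega

/-- One scheme meets both bounds with equality and achievability is upward closed, so the region is
attained without passing to limits. -/
lemma achievable_eq (F : Type*) [Field F] [Fintype F] {K T G : ℕ} (hT : T + 2 ≤ K) (hG : 2 ≤ G)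
    (hGK : G ≤ K - T) : achievable F K T G = {r : ℝ × ℝ | 1 ≤ r.1 ∧
      ((K : ℝ) - (T : ℝ) - 1) / ((K - T).choose G : ℝ) ≤ r.2} := by
  have hcast : (K : ℝ) - T - 1 = ((K - T - 1 : ℕ) : ℝ) := by
    rw [Nat.cast_sub (by omega), Nat.cast_sub (by omega), Nat.cast_one]
  have hpos : 0 < (K - T).choose G := Nat.choose_pos hGK
  rw [hcast]
  ext ⟨R, RS⟩
  constructor
  · rintro ⟨L, LX, LS, hL, c, hc, hs, hR, hRS⟩
    refine ⟨le_trans ?_ hR, (choose_cast_div_le hL hpos (key_length_le (by omega) hc hs)).trans hRS⟩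
    rw [one_le_div (by exact_mod_cast hL)]
    exact_mod_cast hc.length_le ⟨0, by omega⟩
  · rintro ⟨hR, hRS⟩
    obtain ⟨n, hn⟩ : ∃ n, K - T = n + 1 := ⟨K - T - 1, by omega⟩
    obtain ⟨L, LS, hL, heq, c, hc, hs⟩ := exists_scheme F (K := K) (T := T) (G := G) (n := n)
      (by omega) (by omega) hG (by omega)
    refine ⟨L, L, LS, hL, c, hc, hs, ?_, le_trans (le_of_eq ?_) hRS⟩
    · rwa [div_self (by exact_mod_cast hL.ne')]
    · rw [hn] at hpos ⊢
      rw [div_eq_div_iff (by exact_mod_cast hL.ne') (by exact_mod_cast hpos.ne'),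
        Nat.add_sub_cancel]
      exact_mod_cast (by rw [heq, mul_comm] : LS * (n + 1).choose G = n * L)

end Region

end SecureSummation

theorem theorem2 (F : Type*) [Field F] [Fintype F] (K T G : ℕ)
    (hK : 2 ≤ K) (hT : T ≤ K - 2) :
    (K - T < G → SecureSummation.optimalRegion F K T G = ∅) ∧
    (2 ≤ G → G ≤ K - T →
      SecureSummation.optimalRegion F K T G =
        {r : ℝ × ℝ | 1 ≤ r.1 ∧
          ((K : ℝ) - (T : ℝ) - 1) / ((K - T).choose G : ℝ) ≤ r.2}) ∧
    (G = 1 → SecureSummation.optimalRegion F K T G = ∅) := by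
  have hT' : T + 2 ≤ K := by omega
  refine ⟨fun hG => ?_, fun hG hGK => ?_, ?_⟩
  · rw [SecureSummation.optimalRegion, SecureSummation.achievable_eq_empty_of_lt F hT' hG,
      closure_empty]
  · rw [SecureSummation.optimalRegion, SecureSummation.achievable_eq F hT' hG hGK]
    exact IsClosed.closure_eq ((isClosed_le continuous_const continuous_fst).inter
      (isClosed_le continuous_const continuous_snd))
  · rintro rfl
    rw [SecureSummation.optimalRegion, closure_empty_iff]
    refine Set.eq_empty_of_forall_notMem ?_
    rintro r ⟨L, LX, LS, hL, c, hc, hs, -⟩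
    exact SecureSummation.not_isSecure_of_one hK hL hc hs
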